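/- \textbf{Lemma (Average number of flips).} Let $H$ be a $k$-local $n$-qubit Hamiltonian (a finite sum of Hermitian operators, each acting non-trivially on at most $k$ qubits) with real matrix elements in the standard basis $\{|x\rangle : x\in\{0,1\}^n\}$ and with a unique (non-degenerate) ground state $\psi$, normalized and with real entries, such that $\pi(x):=|\langle x|\psi\rangle|^2>0$ for all $x$. Let $S^+$ be the set of pairs $(x,y)$ with $x\neq y$ and $\langle\psi|x\rangle\langle x|H|y\rangle\langle y|\psi\rangle>0$, and let $F$ be the fixed-node Hamiltonian: for $x\ne y$, $\langle x|F|y\rangle=0$ if $(x,y)\in S^+$ and $\langle x|F|y\rangle=\langle x|H|y\rangle$ otherwise, while \[ \langle x|F|x\rangle=\langle x|H|x\rangle+\sum_{z:(x,z)\in S^+}\langle x|H|z\rangle\frac{\langle z|\psi\rangle}{\langle x|\psi\rangle}. \] Let $F_{\mathsf{od}}$ be obtained from $F$ by setting all diagonal matrix elements to zero, let $\lambda_1(F)$ be the smallest eigenvalue of $F$, and let $G$ be the generator matrix \[ \langle x|G|y\rangle=\lambda_1(F)\,\delta_{x,y}-\langle x|F|y\rangle\frac{\langle x|\psi\rangle}{\langle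 y|\psi\rangle}. \] For a starting state $x_{in}$ and an evolution time $t\ge 0$, Gillespie's algorithm sets $x=x_{in}$, $\tau=0$ and repeats: draw a fresh independent $u$ uniformly from $[0,1]$ and increase $\tau$ by $\log(1/u)/|\langle x|G|x\rangle|$ (by $\infty$ if $\langle x|G|x\rangle=0$); if $\tau\ge t$, stop; otherwise replace $x$ by a state $y\neq x$ drawn independently with probability $\langle y|G|x\rangle/|\langle x|G|x\rangle|$ (a flip). Let $m(x_{in},t)$ be the random number of flips performed. Then $\mathbb E[m(x_{in},t)]<\infty$ for every $x_{in}$, and \[ \sum_{x_{in}}\pi(x_{in})\,\mathbb E[m(x_{in},t)]=-t\,\langle\psi|F_{\mathsf{od}}|\psi\rangle . \] Consequently, if the starting state is drawn from $\pi$, the average number of flips in time $t$ is at most $t\,n^k\,\|H\|$, where $\|H\|$ is the operator norm. -/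

import Mathlib

open scoped Matrix ENNReal
open MeasureTheory

noncomputable section

namespace FixedNode

/-- Computational basis states of `n` qubits. -/
abbrev Bits (n : ℕ) : Type := Fin n → Bool

/-- `T` acts nontrivially only on the qubits in `S`, i.e. `T = A ⊗ I` with `A` acting on the
qubits in `S` and the identity on all the others. -/
def ActsOn {n : ℕ} (S : Finset (Fin n)) (T : Matrix (Bits n) (Bits n) ℂ) : Prop :=
  ∃ A : Matrix (S → Bool) (S → Bool) ℂ, ∀ x y : Bits n,
    T x y = if ∀ i, i ∉ S → x i = y i then A (fun i => x i) (fun i => y i) else 0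

/-- `H` is a finite sum of Hermitian operators, each of which acts nontrivially on at most
`k` qubits. -/
def IsLocal {n : ℕ} (k : ℕ) (H : Matrix (Bits n) (Bits n) ℂ) : Prop :=
  ∃ (m : ℕ) (S : Fin m → Finset (Fin n)) (T : Fin m → Matrix (Bits n) (Bits n) ℂ),
    (∀ a, (S a).card ≤ k ∧ (T a).IsHermitian ∧ ActsOn (S a) (T a)) ∧ H = ∑ a, T a

/-- The smallest eigenvalue of a real symmetric matrix. -/
def groundEnergy {n : ℕ} (M : Matrix (Bits n) (Bits n) ℝ) : ℝ := sInf (spectrum ℝ M)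

/-- `ψ` is a normalized ground state of `M`, and the ground space is spanned by `ψ`. -/
structure IsUniqueGroundState {n : ℕ} (M : Matrix (Bits n) (Bits n) ℝ) (ψ : Bits n → ℝ) :
    Prop where
  normalized : ψ ⬝ᵥ ψ = 1
  ground : M *ᵥ ψ = groundEnergy M • ψ
  unique : ∀ φ : Bits n → ℝ, M *ᵥ φ = groundEnergy M • φ → ∃ c : ℝ, φ = c • ψ

/-- The set of pairs `x ≠ y` with `⟨ψ|x⟩⟨x|H|y⟩⟨y|ψ⟩ > 0`; the remaining pairs `x ≠ y` form the
set `S⁻`. -/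
def SPlus {n : ℕ} (H : Matrix (Bits n) (Bits n) ℝ) (ψ : Bits n → ℝ) : Set (Bits n × Bits n) :=
  {p | p.1 ≠ p.2 ∧ 0 < ψ p.1 * H p.1 p.2 * ψ p.2}

open Classical in
/-- The fixed-node Hamiltonian `F` of `H` and `ψ`. -/
def fixedNode {n : ℕ} (H : Matrix (Bits n) (Bits n) ℝ) (ψ : Bits n → ℝ) :
    Matrix (Bits n) (Bits n) ℝ :=
  Matrix.of fun x y =>
    if x = y then H x x + ∑ z, if (x, z) ∈ SPlus H ψ then H x z * (ψ z / ψ x) else 0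
    else if (x, y) ∈ SPlus H ψ then 0
    else H x y

/-- The off-diagonal part of a matrix. -/
def offDiag {n : ℕ} (M : Matrix (Bits n) (Bits n) ℝ) : Matrix (Bits n) (Bits n) ℝ :=
  Matrix.of fun x y => if x = y then 0 else M x y

/-- The generator `⟨x|G|y⟩ = λ₁(F) δ_{x,y} - ⟨x|F|y⟩ ⟨x|ψ⟩ / ⟨y|ψ⟩`. For `x ≠ y` the entry
`G x y` is the rate of transitions from `y` to `x`. -/
def generator {n : ℕ} (H : Matrix (Bits n) (Bits n) ℝ) (ψ : Bits n → ℝ) :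
    Matrix (Bits n) (Bits n) ℝ :=
  Matrix.of fun x y =>
    (if x = y then groundEnergy (fixedNode H ψ) else 0) - fixedNode H ψ x y * (ψ x / ψ y)

/-- The probability `⟨y|G|x⟩ / |⟨x|G|x⟩|` that a jump from `x` leads to `y ≠ x`. -/
def jumpWeight {n : ℕ} (G : Matrix (Bits n) (Bits n) ℝ) (x y : Bits n) : ℝ≥0∞ :=
  if y = x then 0 else ENNReal.ofReal (G y x / |G x x|)

open Classical in
/-- The distribution of the state to which the process jumps from `x`. For a generator `G` the
weights sum to one unless `G x x = 0`; in that case `x` is absorbing, and the value is irrelevant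
because the waiting time in `x` is infinite. -/
def jumpLaw {n : ℕ} (G : Matrix (Bits n) (Bits n) ℝ) (x : Bits n) : PMF (Bits n) :=
  if h : ∑ y, jumpWeight G x y = 1 then PMF.ofFintype (jumpWeight G x) h else PMF.pure x

/-- The random input of the algorithm. In its `j`-th iteration the algorithm uses `(ω j).1`, a
sample `u` of the uniform distribution on `[0,1]`, and `(ω j).2 x`, a sample from the jump
distribution of `x`, where `x` is the current state. -/
abbrev Noise (n : ℕ) : Type := ℕ → unitInterval × (Bits n → Bits n)

/-- All samples are independent, the `u`s are uniform, and a next state proposed for the current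
state `x` has the law `jumpLaw G x`. -/
def noiseLaw {n : ℕ} (G : Matrix (Bits n) (Bits n) ℝ) : Measure (Noise n) :=
  Measure.infinitePi fun _ : ℕ =>
    (volume : Measure unitInterval).prod (Measure.pi fun x => (jumpLaw G x).toMeasure)

/-- The waiting time `log (1 / u) / |⟨x|G|x⟩|` in the state `x`; it is infinite (for `u < 1`) if
`x` is absorbing. -/
def waitingTime {n : ℕ} (G : Matrix (Bits n) (Bits n) ℝ) (x : Bits n) (u : unitInterval) :
    ℝ≥0∞ :=
  ENNReal.ofReal (Real.log (1 / (u : ℝ))) / ENNReal.ofReal |G x x|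

/-- The pair `(x, τ)` held by Gillespie's algorithm with the starting state `xin` at the beginning
of its `j`-th iteration (the stopping rule is not applied here): the current state `x`, and the
time `τ` at which it was entered. -/
def run {n : ℕ} (G : Matrix (Bits n) (Bits n) ℝ) (xin : Bits n) (ω : Noise n) :
    ℕ → Bits n × ℝ≥0∞
  | 0 => (xin, 0)
  | j + 1 =>
    ((ω j).2 (run G xin ω j).1, (run G xin ω j).2 + waitingTime G (run G xin ω j).1 (ω j).1)

/-- The number `m(xin, t)` of flips performed by Gillespie's algorithm with the evolution time
`t`: the algorithm stops as soon as `τ ≥ t`, so the `j`-th flip is performed if and only if it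
takes place at a time `τ < t`. -/
def flips {n : ℕ} (G : Matrix (Bits n) (Bits n) ℝ) (xin : Bits n) (t : ℝ) (ω : Noise n) : ℕ∞ :=
  {j : ℕ | (run G xin ω (j + 1)).2 < ENNReal.ofReal t}.encard

/-- The expected number of flips for the starting state `xin`. -/
def expectedFlips {n : ℕ} (G : Matrix (Bits n) (Bits n) ℝ) (xin : Bits n) (t : ℝ) : ℝ≥0∞ :=
  ∫⁻ ω, (flips G xin t ω : ℝ≥0∞) ∂(noiseLaw G)

end FixedNode

end

/-! The weight `ψ x ^ 2` is stationary for `G`. The diagonal correction makes `F *ᵥ ψ = H *ᵥ ψ = e •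
ψ`, and every off-diagonal product `ψ x * F x y * ψ y` is nonpositive, so a Perron–Frobenius
argument (`groundEnergy_eq_of_mulVec`) identifies `e` as the smallest eigenvalue of `F`. With that
constant, `G` has nonnegative off-diagonal rates, zero column sums and kernel vector `ψ ^ 2`.

The law of the state at time `t` is never computed. Conditioning on the first flip gives a renewal
equation for the mean counts `a x r` (`expectedFlips_renewal`), proved for counts among the first
`J` flips and passed to the limit. In differential form it reads `a' = Gᵀ a + q` with `q x = -G x
x`. Pairing with the stationary weight kills `Gᵀ a`, so the average grows linearly with slope `∑ ψ x
^ 2 * q x` (`sum_mul_renewal_solution`), which equals `-⟨ψ|F_od|ψ⟩`. Comparison with `Q * r`, where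
`Q` bounds the rates, gives finiteness.

For the last bound, a row of `H` has at most `n ^ k` nonzero off-diagonal entries, each at most
`‖H‖` in modulus, and `|ψ x| * |ψ y|` is split by AM–GM. -/

namespace FixedNode

variable {n : ℕ}

/-! ### Independent noise and the first-step decomposition -/

/-- Prepending an independent sample to an i.i.d. sequence gives an i.i.d. sequence. -/
theorem measurePreserving_cons_infinitePi {X : Type*} [MeasurableSpace X] (μ : Measure X)
    [IsProbabilityMeasure μ] :
    MeasurePreserving (fun p : X × (ℕ → X) => (fun i => Nat.casesOn i p.1 p.2 : ℕ → X))
      (μ.prod (Measure.infinitePi fun _ : ℕ => μ)) (Measure.infinitePi fun _ : ℕ => μ) := by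
  have hm : Measurable (fun p : X × (ℕ → X) => (fun i => Nat.casesOn i p.1 p.2 : ℕ → X)) := by
    refine measurable_pi_lambda _ fun i => ?_
    cases i with
    | zero => exact measurable_fst
    | succ i => exact (measurable_pi_apply i).comp measurable_snd
  refine ⟨hm, Measure.eq_infinitePi _ fun s t ht => ?_⟩
  classical
  -- Enlarging the cylinder to an initial segment, free outside `s`, guarantees that it contains
  -- coordinate 0, which can then be split off.
  obtain ⟨N, hN⟩ := s.exists_nat_subset_range
  have hs : s ⊆ Finset.range (N + 1) :=
    hN.trans (Finset.range_subset_range.2 (Nat.le_succ N))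
  let t' : ℕ → Set X := fun i => if i ∈ s then t i else Set.univ
  have ht' : ∀ i, MeasurableSet (t' i) := fun i => by
    by_cases hi : i ∈ s <;> simp [t', hi, ht]
  have hpi : Set.pi (s : Set ℕ) t = Set.pi (Finset.range (N + 1) : Set ℕ) t' := by
    ext f
    simp only [Set.mem_pi, Finset.mem_coe]
    refine ⟨fun h i _ => ?_, fun h i hi => ?_⟩
    · by_cases hi : i ∈ s <;> simp [t', hi, h]
    · simpa [t', hi] using h i (hs hi)
  have hprod : ∏ i ∈ s, μ (t i) = ∏ i ∈ Finset.range (N + 1), μ (t' i) := by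
    rw [← Finset.prod_subset hs]
    · exact Finset.prod_congr rfl fun i hi => by simp [t', hi]
    · intro i _ hi
      simp [t', hi]
  have hpre : (fun p : X × (ℕ → X) => (fun i => Nat.casesOn i p.1 p.2 : ℕ → X)) ⁻¹'
      (Set.pi (Finset.range (N + 1) : Set ℕ) t') =
      t' 0 ×ˢ Set.pi (Finset.range N : Set ℕ) fun i => t' (i + 1) := by
    ext p
    simp only [Set.mem_preimage, Set.mem_pi, Finset.mem_coe, Finset.mem_range, Set.mem_prod]
    refine ⟨fun h => ⟨h 0 (Nat.succ_pos N), fun i hi => h (i + 1) (by omega)⟩, fun h i hi => ?_⟩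
    cases i with
    | zero => exact h.1
    | succ i => exact h.2 i (by omega)
  rw [hpi, hprod, Measure.map_apply hm
    (MeasurableSet.pi (Finset.countable_toSet _) fun i _ => ht' i), hpre, Measure.prod_prod,
    Measure.infinitePi_pi _ (fun i _ => ht' (i + 1)), Finset.prod_range_succ', mul_comm]

theorem measurable_waitingTime (G : Matrix (Bits n) (Bits n) ℝ) (x : Bits n) :
    Measurable (waitingTime G x) := by
  unfold waitingTime
  fun_prop

theorem measurable_run (G : Matrix (Bits n) (Bits n) ℝ) (x : Bits n) (j : ℕ) :
    Measurable fun ω : Noise n => run G x ω j := by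
  induction j with
  | zero => exact measurable_const
  | succ j ih =>
    have h1 : Measurable fun p : (Bits n → Bits n) × Bits n => p.1 p.2 :=
      measurable_from_prod_countable_left fun y => measurable_pi_apply y
    have h2 : Measurable fun p : unitInterval × Bits n => waitingTime G p.2 p.1 :=
      measurable_from_prod_countable_left fun y => measurable_waitingTime G y
    refine Measurable.prodMk ?_ ?_
    · exact h1.comp ((measurable_snd.comp (measurable_pi_apply j)).prodMk
        (measurable_fst.comp ih))
    · exact (measurable_snd.comp ih).add
        (h2.comp ((measurable_fst.comp (measurable_pi_apply j)).prodMk (measurable_fst.comp ih)))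

/-- The run after its first iteration is a run on the remaining noise. -/
theorem run_succ_eq_shift (G : Matrix (Bits n) (Bits n) ℝ) (x : Bits n) (ω : Noise n) (j : ℕ) :
    run G x ω (j + 1) =
      ((run G ((ω 0).2 x) (fun i => ω (i + 1)) j).1,
        waitingTime G x (ω 0).1 + (run G ((ω 0).2 x) (fun i => ω (i + 1)) j).2) := by
  induction j with
  | zero => simp [run]
  | succ j ih =>
    rw [run, ih]
    simp only [run, add_assoc]

/-- The number of flips among the first `J` ones that take place before the time `r`. -/
noncomputable def flipsAmong (G : Matrix (Bits n) (Bits n) ℝ) (r : ℝ≥0∞) (J : ℕ) (x : Bits n)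
    (ω : Noise n) : ℝ≥0∞ :=
  ∑ j ∈ Finset.range J, if (run G x ω (j + 1)).2 < r then 1 else 0

/-- The expectation of `flipsAmong`. -/
noncomputable def meanFlipsAmong (G : Matrix (Bits n) (Bits n) ℝ) (J : ℕ) (x : Bits n)
    (r : ℝ≥0∞) : ℝ≥0∞ :=
  ∫⁻ ω, flipsAmong G r J x ω ∂(noiseLaw G)

theorem measurable_flipsAmong (G : Matrix (Bits n) (Bits n) ℝ) (r : ℝ≥0∞) (J : ℕ) (x : Bits n) :
    Measurable (flipsAmong G r J x) := by
  refine Finset.measurable_fun_sum _ fun j _ => ?_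
  exact Measurable.ite (measurableSet_lt (measurable_snd.comp (measurable_run G x (j + 1)))
    measurable_const) measurable_const measurable_const

/-- Monotonicity in the time budget also supplies measurability in it, as needed under the integrals
below. -/
theorem monotone_meanFlipsAmong (G : Matrix (Bits n) (Bits n) ℝ) (J : ℕ) (x : Bits n) :
    Monotone (meanFlipsAmong G J x) := by
  intro r r' h
  refine lintegral_mono fun ω => Finset.sum_le_sum fun j _ => ?_
  split_ifs with h1 h2
  · exact le_rfl
  · exact absurd (h1.trans_le h) h2
  · exact zero_le
  · exact le_rfl

theorem flipsAmong_mono (G : Matrix (Bits n) (Bits n) ℝ) (r : ℝ≥0∞) (x : Bits n) (ω : Noise n) :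
    Monotone fun J => flipsAmong G r J x ω := fun _ _ h =>
  Finset.sum_le_sum_of_subset (Finset.range_subset_range.2 h)

theorem meanFlipsAmong_mono (G : Matrix (Bits n) (Bits n) ℝ) (x : Bits n) (r : ℝ≥0∞) :
    Monotone fun J => meanFlipsAmong G J x r := fun _ _ h =>
  lintegral_mono fun ω => flipsAmong_mono G r x ω h

theorem flips_eq_iSup_flipsAmong (G : Matrix (Bits n) (Bits n) ℝ) (x : Bits n) (t : ℝ)
    (ω : Noise n) : (flips G x t ω : ℝ≥0∞) = ⨆ J, flipsAmong G (ENNReal.ofReal t) J x ω := by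
  rw [flips, ← ENNReal.tsum_set_one,
    tsum_subtype {j : ℕ | (run G x ω (j + 1)).2 < ENNReal.ofReal t} fun _ => (1 : ℝ≥0∞),
    ENNReal.tsum_eq_iSup_nat]
  simp only [flipsAmong, Set.indicator_apply, Set.mem_ofPred_eq]

theorem expectedFlips_eq_iSup (G : Matrix (Bits n) (Bits n) ℝ) (x : Bits n) (t : ℝ) :
    expectedFlips G x t = ⨆ J, meanFlipsAmong G J x (ENNReal.ofReal t) := by
  simp only [expectedFlips, flips_eq_iSup_flipsAmong]
  exact lintegral_iSup (fun J => measurable_flipsAmong G _ J x)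
    fun _ _ h ω => flipsAmong_mono G _ x ω h

/-- After the first flip the process restarts with budget `r - w`. Truncated subtraction is
harmless: `w + τ < r` is equivalent to `τ < r - w`, even for `w = ⊤`. -/
theorem flipsAmong_succ (G : Matrix (Bits n) (Bits n) ℝ) (r : ℝ≥0∞) (J : ℕ) (x : Bits n)
    (ω : Noise n) :
    flipsAmong G r (J + 1) x ω = (if waitingTime G x (ω 0).1 < r then 1 else 0) +
      flipsAmong G (r - waitingTime G x (ω 0).1) J ((ω 0).2 x) (fun i => ω (i + 1)) := by
  rw [flipsAmong, Finset.sum_range_succ', add_comm]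
  congr 1
  · simp [run]
  · refine Finset.sum_congr rfl fun j _ => ?_
    rw [run_succ_eq_shift G x ω (j + 1)]
    simp only [lt_tsub_iff_left]

/-- First-step decomposition of the mean number of flips. -/
theorem meanFlipsAmong_succ (G : Matrix (Bits n) (Bits n) ℝ) (J : ℕ) (x : Bits n) (r : ℝ≥0∞) :
    meanFlipsAmong G (J + 1) x r = ∫⁻ u : unitInterval, ∑ y,
      ((if waitingTime G x u < r then 1 else 0) + meanFlipsAmong G J y (r - waitingTime G x u))
        * jumpLaw G x y := by
  set ν : Measure (Bits n → Bits n) := Measure.pi fun x => (jumpLaw G x).toMeasure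
  have hcons := measurePreserving_cons_infinitePi ((volume : Measure unitInterval).prod ν)
  have hmeas : ∀ y, Measurable fun u : unitInterval =>
      ((if waitingTime G x u < r then 1 else 0) + meanFlipsAmong G J y (r - waitingTime G x u)) := by
    intro y
    refine Measurable.add (Measurable.ite (measurableSet_lt (measurable_waitingTime G x)
      measurable_const) measurable_const measurable_const) ?_
    exact (monotone_meanFlipsAmong G J y).measurable.comp
      (measurable_const.sub (measurable_waitingTime G x))
  have hmeas2 : Measurable fun p : unitInterval × Bits n =>
      ((if waitingTime G x p.1 < r then 1 else 0) +
        meanFlipsAmong G J p.2 (r - waitingTime G x p.1)) :=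
    measurable_from_prod_countable_left hmeas
  rw [meanFlipsAmong, noiseLaw, ← hcons.lintegral_comp (measurable_flipsAmong G r (J + 1) x),
    lintegral_prod (fun p : (unitInterval × (Bits n → Bits n)) × Noise n =>
        flipsAmong G r (J + 1) x fun i => Nat.casesOn i p.1 p.2)
      ((measurable_flipsAmong G r (J + 1) x).comp hcons.measurable).aemeasurable]
  have h1 : ∀ a : unitInterval × (Bits n → Bits n),
      ∫⁻ ω, flipsAmong G r (J + 1) x (fun i => Nat.casesOn i a ω)
        ∂(Measure.infinitePi fun _ : ℕ => (volume : Measure unitInterval).prod ν) =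
      (if waitingTime G x a.1 < r then 1 else 0) +
        meanFlipsAmong G J (a.2 x) (r - waitingTime G x a.1) := by
    intro a
    simp only [flipsAmong_succ]
    change ∫⁻ ω, (if waitingTime G x a.1 < r then 1 else 0) +
      flipsAmong G (r - waitingTime G x a.1) J (a.2 x) ω ∂_ = _
    rw [lintegral_add_left measurable_const, lintegral_const, measure_univ, mul_one]
    rfl
  simp only [h1]
  have h2 : Measurable fun a : unitInterval × (Bits n → Bits n) => (a.1, a.2 x) :=
    measurable_fst.prodMk ((measurable_pi_apply x).comp measurable_snd)
  rw [lintegral_prod (fun a : unitInterval × (Bits n → Bits n) =>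
    (if waitingTime G x a.1 < r then 1 else 0) +
      meanFlipsAmong G J (a.2 x) (r - waitingTime G x a.1)) (hmeas2.comp h2).aemeasurable]
  refine lintegral_congr fun u => ?_
  -- Of all the proposed next states, the first iteration reads only the one at `x`.
  have h3 : MeasurePreserving (Function.eval x) ν (jumpLaw G x).toMeasure :=
    measurePreserving_eval _ x
  rw [h3.lintegral_comp (f := fun y => (if waitingTime G x u < r then 1 else 0) +
        meanFlipsAmong G J y (r - waitingTime G x u)) (measurable_of_countable _), lintegral_fintype]
  simp

/-! ### Exponential waiting times and the renewal equation -/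

/-- `log (1 / u) / q` is exponentially distributed with rate `q` if `u` is uniform. -/
theorem lintegral_log_inv_div {q : ℝ} (hq : 0 < q) (f : ℝ → ℝ≥0∞) :
    ∫⁻ u : unitInterval, f (Real.log (1 / (u : ℝ)) / q) =
      ∫⁻ s in Set.Ioi (0 : ℝ), ENNReal.ofReal (q * Real.exp (-q * s)) * f s := by
  have himg : (fun s : ℝ => Real.exp (-q * s)) '' Set.Ioi 0 = Set.Ioo 0 1 := by
    ext u
    simp only [Set.mem_image, Set.mem_Ioi, Set.mem_Ioo]
    constructor
    · rintro ⟨s, hs, rfl⟩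
      exact ⟨Real.exp_pos _, by rw [Real.exp_lt_one_iff]; nlinarith⟩
    · rintro ⟨h0, h1⟩
      refine ⟨-Real.log u / q, div_pos (neg_pos.2 (Real.log_neg h0 h1)) hq, ?_⟩
      rw [show -q * (-Real.log u / q) = Real.log u by field_simp, Real.exp_log h0]
  have hder : ∀ s ∈ Set.Ioi (0 : ℝ), HasDerivWithinAt (fun s : ℝ => Real.exp (-q * s))
      (Real.exp (-q * s) * -q) (Set.Ioi 0) s := fun s _ => by
    simpa using (((hasDerivAt_id s).const_mul (-q)).exp).hasDerivWithinAt
  have hinj : Set.InjOn (fun s : ℝ => Real.exp (-q * s)) (Set.Ioi 0) := fun a _ b _ h => by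
    have := Real.exp_injective h
    exact mul_left_cancel₀ (neg_ne_zero.2 hq.ne') this
  calc ∫⁻ u : unitInterval, f (Real.log (1 / (u : ℝ)) / q)
      = ∫⁻ u in Set.Icc (0 : ℝ) 1, f (Real.log (1 / u) / q) :=
        lintegral_subtype_comap measurableSet_Icc fun u : ℝ => f (Real.log (1 / u) / q)
    _ = ∫⁻ u in Set.Ioo (0 : ℝ) 1, f (Real.log (1 / u) / q) := by
        rw [Measure.restrict_congr_set Ioo_ae_eq_Icc]
    _ = _ := by
        rw [← himg, lintegral_image_eq_lintegral_abs_deriv_mul measurableSet_Ioi hder hinj]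
        refine lintegral_congr fun s => ?_
        rw [one_div, ← Real.exp_neg, Real.log_exp, abs_mul, abs_neg, abs_of_pos hq,
          abs_of_pos (Real.exp_pos _), mul_comm q]
        congr 2
        field_simp

/-- `G` is the generator of a Markov process: `G x y ≥ 0` is the rate of transitions from `y` to
`x ≠ y`, and the columns sum to zero. -/
structure IsGenerator (G : Matrix (Bits n) (Bits n) ℝ) : Prop where
  nonneg : ∀ x y, x ≠ y → 0 ≤ G x y
  sum_col : ∀ y, ∑ x, G x y = 0

namespace IsGenerator

variable {G : Matrix (Bits n) (Bits n) ℝ}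

theorem sum_rate (hG : IsGenerator G) (x : Bits n) :
    ∑ y, (if y = x then 0 else G y x) = -G x x := by
  have h := hG.sum_col x
  rw [← Finset.add_sum_erase _ _ (Finset.mem_univ x)] at h
  rw [← Finset.add_sum_erase _ _ (Finset.mem_univ x), if_pos rfl, zero_add,
    Finset.sum_congr rfl fun y hy => if_neg (Finset.ne_of_mem_erase hy)]
  linarith

theorem rate_nonneg (hG : IsGenerator G) (x y : Bits n) : 0 ≤ if y = x then 0 else G y x := by
  split_ifs with h
  · exact le_rfl
  · exact hG.nonneg y x h

theorem diag_nonpos (hG : IsGenerator G) (x : Bits n) : G x x ≤ 0 := by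
  have := Finset.sum_nonneg fun y (_ : y ∈ Finset.univ) => hG.rate_nonneg x y
  rw [hG.sum_rate] at this
  linarith

theorem sum_jumpWeight (hG : IsGenerator G) {x : Bits n} (hx : G x x ≠ 0) :
    ∑ y, jumpWeight G x y = 1 := by
  have hq : 0 < -G x x := neg_pos.2 (lt_of_le_of_ne (hG.diag_nonpos x) hx)
  have h : ∀ y, jumpWeight G x y =
      ENNReal.ofReal ((if y = x then 0 else G y x) / (-G x x)) := fun y => by
    unfold jumpWeight
    split_ifs
    · simp
    · rw [abs_of_nonpos (hG.diag_nonpos x)]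
  simp only [h]
  rw [← ENNReal.ofReal_sum_of_nonneg fun y _ => div_nonneg (hG.rate_nonneg x y) hq.le,
    ← Finset.sum_div, hG.sum_rate, div_self hq.ne', ENNReal.ofReal_one]

/-- The exponential density carries the factor `-G x x`, which cancels the normalization of the jump
probabilities; the default branch of `jumpLaw` never enters. -/
theorem rate_mul_jumpLaw (hG : IsGenerator G) {x : Bits n} (hx : G x x ≠ 0) (y : Bits n) :
    ENNReal.ofReal (-G x x) * jumpLaw G x y = ENNReal.ofReal (if y = x then 0 else G y x) := by
  have hq : 0 < -G x x := neg_pos.2 (lt_of_le_of_ne (hG.diag_nonpos x) hx)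
  rw [jumpLaw, dif_pos (hG.sum_jumpWeight hx), PMF.ofFintype_apply, jumpWeight]
  split_ifs
  · simp
  · rw [abs_of_nonpos (hG.diag_nonpos x), ← ENNReal.ofReal_mul hq.le, mul_div_cancel₀ _ hq.ne']

end IsGenerator

theorem meanFlipsAmong_zero_time (G : Matrix (Bits n) (Bits n) ℝ) (J : ℕ) (x : Bits n) :
    meanFlipsAmong G J x 0 = 0 := by
  simp [meanFlipsAmong, flipsAmong]

theorem waitingTime_absorbing_ae {G : Matrix (Bits n) (Bits n) ℝ} {x : Bits n} (hx : G x x = 0) :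
    ∀ᵐ u : unitInterval, waitingTime G x u = ⊤ := by
  -- Both endpoints are exceptional: the conventions for `1 / 0` and `log 0` at `u = 0`, and `log 1
  -- = 0` at `u = 1`, give the waiting time `0 / 0 = 0`.
  have h0 : ∀ᵐ u : unitInterval, u ≠ 0 := by simp [ae_iff]
  have h1 : ∀ᵐ u : unitInterval, u ≠ 1 := by simp [ae_iff]
  filter_upwards [h0, h1] with u hu0 hu1
  have hpos : 0 < (u : ℝ) := lt_of_le_of_ne u.2.1 fun h => hu0 (Subtype.ext h.symm)
  have hlt : (u : ℝ) < 1 := lt_of_le_of_ne u.2.2 fun h => hu1 (Subtype.ext h)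
  rw [waitingTime, hx, abs_zero, ENNReal.ofReal_zero]
  refine ENNReal.div_zero (ENNReal.ofReal_pos.2 (Real.log_pos ?_)).ne'
  rw [one_div]
  exact (one_lt_inv₀ hpos).2 hlt

/-- The renewal equation for the truncated mean number of flips. -/
theorem meanFlipsAmong_renewal {G : Matrix (Bits n) (Bits n) ℝ} (hG : IsGenerator G) (J : ℕ)
    (x : Bits n) (r : ℝ) :
    meanFlipsAmong G (J + 1) x (ENNReal.ofReal r) =
      ∫⁻ s in Set.Ioo 0 r, ENNReal.ofReal (Real.exp (G x x * s)) *
        (ENNReal.ofReal (-G x x) + ∑ y, ENNReal.ofReal (if y = x then 0 else G y x) *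
          meanFlipsAmong G J y (ENNReal.ofReal (r - s))) := by
  rw [meanFlipsAmong_succ]
  by_cases hx : G x x = 0
  -- In an absorbing state the nonnegative rates sum to zero, hence vanish, and both sides are zero.
  · have hrate : ∀ y, (if y = x then 0 else G y x) = 0 := fun y =>
      (Finset.sum_eq_zero_iff_of_nonneg fun y _ => hG.rate_nonneg x y).1
        ((hG.sum_rate x).trans (by simp [hx])) y (Finset.mem_univ y)
    simp only [hrate, hx, neg_zero, ENNReal.ofReal_zero, zero_mul, Finset.sum_const_zero,
      add_zero, mul_zero, lintegral_zero]
    refine (lintegral_congr_ae ?_).trans lintegral_zero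
    filter_upwards [waitingTime_absorbing_ae hx] with u hu
    simp [hu, meanFlipsAmong_zero_time]
  · have hq : 0 < -G x x := neg_pos.2 (lt_of_le_of_ne (hG.diag_nonpos x) hx)
    have hw : ∀ u : unitInterval,
        waitingTime G x u = ENNReal.ofReal (Real.log (1 / (u : ℝ)) / (-G x x)) := fun u => by
      rw [waitingTime, abs_of_nonpos (hG.diag_nonpos x), ENNReal.ofReal_div_of_pos hq]
    simp only [hw]
    rw [lintegral_log_inv_div hq fun s => ∑ y,
      ((if ENNReal.ofReal s < ENNReal.ofReal r then 1 else 0) +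
        meanFlipsAmong G J y (ENNReal.ofReal r - ENNReal.ofReal s)) * jumpLaw G x y]
    have hsum : ∑ y, jumpLaw G x y = 1 := by
      rw [← tsum_fintype (L := .unconditional _)]
      exact (jumpLaw G x).tsum_coe
    rw [← lintegral_indicator measurableSet_Ioi, ← lintegral_indicator measurableSet_Ioo]
    refine lintegral_congr fun s => ?_
    by_cases hs : 0 < s
    · by_cases hr : s < r
      · rw [Set.indicator_of_mem (Set.mem_Ioi.2 hs),
          Set.indicator_of_mem (Set.mem_Ioo.2 ⟨hs, hr⟩),
          if_pos ((ENNReal.ofReal_lt_ofReal_iff (hs.trans hr)).2 hr)]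
        simp only [add_mul, one_mul, Finset.sum_add_distrib, hsum, ← ENNReal.ofReal_sub r hs.le]
        rw [ENNReal.ofReal_mul hq.le, mul_comm (ENNReal.ofReal (-G x x)), mul_assoc, mul_add,
          mul_one, neg_neg, Finset.mul_sum]
        congr 2
        refine Finset.sum_congr rfl fun y _ => ?_
        rw [← hG.rate_mul_jumpLaw hx y, mul_comm (meanFlipsAmong _ _ _ _), mul_assoc]
      · have hsr : ENNReal.ofReal r ≤ ENNReal.ofReal s := ENNReal.ofReal_le_ofReal (not_lt.1 hr)
        rw [Set.indicator_of_mem (Set.mem_Ioi.2 hs),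
          Set.indicator_of_notMem (s := Set.Ioo 0 r) (fun h => hr (Set.mem_Ioo.1 h).2)]
        simp [tsub_eq_zero_of_le hsr, hsr.not_gt, meanFlipsAmong_zero_time]
    · rw [Set.indicator_of_notMem (s := Set.Ioi 0) (fun h => hs (Set.mem_Ioi.1 h)),
        Set.indicator_of_notMem (s := Set.Ioo 0 r) (fun h => hs (Set.mem_Ioo.1 h).1)]

/-- The renewal equation for the mean number of flips. -/
theorem expectedFlips_renewal {G : Matrix (Bits n) (Bits n) ℝ} (hG : IsGenerator G)
    (x : Bits n) (r : ℝ) :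
    expectedFlips G x r =
      ∫⁻ s in Set.Ioo 0 r, ENNReal.ofReal (Real.exp (G x x * s)) *
        (ENNReal.ofReal (-G x x) + ∑ y, ENNReal.ofReal (if y = x then 0 else G y x) *
          expectedFlips G y (r - s)) := by
  have hmono : ∀ s, Monotone fun J => ENNReal.ofReal (Real.exp (G x x * s)) *
        (ENNReal.ofReal (-G x x) + ∑ y, ENNReal.ofReal (if y = x then 0 else G y x) *
          meanFlipsAmong G J y (ENNReal.ofReal (r - s))) := fun s J J' h => by
    dsimp only
    gcongr with y
    exact meanFlipsAmong_mono G y _ h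
  have h1 : ∀ s, ENNReal.ofReal (Real.exp (G x x * s)) *
        (ENNReal.ofReal (-G x x) + ∑ y, ENNReal.ofReal (if y = x then 0 else G y x) *
          expectedFlips G y (r - s)) = ⨆ J, ENNReal.ofReal (Real.exp (G x x * s)) *
        (ENNReal.ofReal (-G x x) + ∑ y, ENNReal.ofReal (if y = x then 0 else G y x) *
          meanFlipsAmong G J y (ENNReal.ofReal (r - s))) := fun s => by
    rw [← ENNReal.mul_iSup, ← ENNReal.add_iSup, ← ENNReal.finsetSum_iSup_of_monotone]
    · simp only [expectedFlips_eq_iSup, ENNReal.mul_iSup]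
    · intro y J J' h
      dsimp only
      gcongr
      exact meanFlipsAmong_mono G y _ h
  simp only [h1]
  -- Monotone convergence in `J`; the shift from `J` to `J + 1` does not change the supremum.
  rw [lintegral_iSup]
  · simp only [← meanFlipsAmong_renewal hG]
    rw [expectedFlips_eq_iSup]
    exact ((meanFlipsAmong_mono G x _).iSup_nat_add 1).symm
  · intro J
    have h2 : ∀ y, Measurable fun s => meanFlipsAmong G J y (ENNReal.ofReal (r - s)) := fun y =>
      (monotone_meanFlipsAmong G J y).measurable.comp (by fun_prop)
    fun_prop
  · exact fun J J' h s => hmono s h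

/-! ### Finiteness and the real-valued renewal equation -/

theorem setLIntegral_Ioo_ofReal {f : ℝ → ℝ} {r : ℝ} (hr : 0 ≤ r)
    (hf : IntervalIntegrable f volume 0 r) (h0 : ∀ s ∈ Set.Ioo 0 r, 0 ≤ f s) :
    ∫⁻ s in Set.Ioo 0 r, ENNReal.ofReal (f s) = ENNReal.ofReal (∫ s in (0 : ℝ)..r, f s) := by
  rw [intervalIntegral.integral_of_le hr, integral_Ioc_eq_integral_Ioo,
    ofReal_integral_eq_lintegral_ofReal]
  · exact ((intervalIntegrable_iff_integrableOn_Ioo_of_le hr).1 hf)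
  · exact (ae_restrict_iff' measurableSet_Ioo).2 (Filter.Eventually.of_forall h0)

/-- The function `Q * r` is a supersolution of the renewal equation: with `Q` as source in place of
`-G x x`, the integrand is the derivative of `-exp (G x x * s) * (Q * (r - s))`, so the integral is
exactly `Q * r`. The bound is uniform in `J`. -/
theorem meanFlipsAmong_le {G : Matrix (Bits n) (Bits n) ℝ} (hG : IsGenerator G) {Q : ℝ}
    (hQ : ∀ x, -G x x ≤ Q) (J : ℕ) (x : Bits n) {r : ℝ} (hr : 0 ≤ r) :
    meanFlipsAmong G J x (ENNReal.ofReal r) ≤ ENNReal.ofReal (Q * r) := by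
  have hQ0 : 0 ≤ Q := (neg_nonneg.2 (hG.diag_nonpos x)).trans (hQ x)
  induction J generalizing x r with
  | zero => simp [meanFlipsAmong, flipsAmong]
  | succ J ih =>
    have hint : ∫ s in (0 : ℝ)..r, Real.exp (G x x * s) * (Q - G x x * (Q * (r - s))) = Q * r := by
      have hder : ∀ s ∈ Set.uIcc 0 r, HasDerivAt (fun s => -(Real.exp (G x x * s) * (Q * (r - s))))
          (Real.exp (G x x * s) * (Q - G x x * (Q * (r - s)))) s := fun s _ => by
        have h1 : HasDerivAt (fun s => Real.exp (G x x * s)) (Real.exp (G x x * s) * G x x) s := by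
          simpa using ((hasDerivAt_id s).const_mul (G x x)).exp
        have h2 : HasDerivAt (fun s => Q * (r - s)) (-Q) s := by
          simpa using ((hasDerivAt_id s).const_sub r).const_mul Q
        exact (h1.mul h2).neg.congr_deriv (by ring)
      rw [intervalIntegral.integral_eq_sub_of_hasDerivAt hder
        (Continuous.intervalIntegrable (by fun_prop) _ _)]
      simp
    rw [meanFlipsAmong_renewal hG, ← hint, ← setLIntegral_Ioo_ofReal hr
      (Continuous.intervalIntegrable (by fun_prop) _ _)]
    · refine setLIntegral_mono (by fun_prop) fun s hs => ?_
      have hs' : 0 ≤ r - s := sub_nonneg.2 hs.2.le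
      calc _ ≤ ENNReal.ofReal (Real.exp (G x x * s)) * (ENNReal.ofReal Q +
              ∑ y, ENNReal.ofReal (if y = x then 0 else G y x) * ENNReal.ofReal (Q * (r - s))) := by
            gcongr with y
            · exact hQ x
            · exact ih y hs'
        _ = _ := by
            rw [← Finset.sum_mul,
              ← ENNReal.ofReal_sum_of_nonneg fun y _ => hG.rate_nonneg x y, hG.sum_rate,
              ← ENNReal.ofReal_mul (neg_nonneg.2 (hG.diag_nonpos x)), ← ENNReal.ofReal_add hQ0
                (mul_nonneg (neg_nonneg.2 (hG.diag_nonpos x)) (mul_nonneg hQ0 hs')),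
              ← ENNReal.ofReal_mul (Real.exp_nonneg _)]
            congr 2
            ring
    · intro s hs
      have h1 : 0 ≤ Q * (r - s) := mul_nonneg hQ0 (sub_nonneg.2 hs.2.le)
      have h2 := hG.diag_nonpos x
      exact mul_nonneg (Real.exp_nonneg _) (by nlinarith)

theorem expectedFlips_ne_top {G : Matrix (Bits n) (Bits n) ℝ} (hG : IsGenerator G) (x : Bits n)
    (t : ℝ) : expectedFlips G x t ≠ ⊤ := by
  obtain ⟨Q, hQ⟩ := (Set.finite_range fun x => -G x x).bddAbove
  have ht : ENNReal.ofReal t = ENNReal.ofReal (max t 0) := by simp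
  rw [expectedFlips_eq_iSup, ht]
  exact ne_top_of_le_ne_top ENNReal.ofReal_ne_top (iSup_le fun J =>
    meanFlipsAmong_le hG (fun y => hQ ⟨y, rfl⟩) J x (le_max_right t 0))

theorem expectedFlips_mono {G : Matrix (Bits n) (Bits n) ℝ} (x : Bits n) :
    Monotone (expectedFlips G x) := fun r r' h => by
  simp only [expectedFlips_eq_iSup]
  exact iSup_mono fun J => monotone_meanFlipsAmong G J x (ENNReal.ofReal_le_ofReal h)

theorem monotone_expectedFlips_toReal {G : Matrix (Bits n) (Bits n) ℝ} (hG : IsGenerator G)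
    (x : Bits n) : Monotone fun t => (expectedFlips G x t).toReal := fun _ _ h =>
  ENNReal.toReal_mono (expectedFlips_ne_top hG x _) (expectedFlips_mono x h)

theorem expectedFlips_toReal_renewal {G : Matrix (Bits n) (Bits n) ℝ} (hG : IsGenerator G)
    (x : Bits n) {r : ℝ} (hr : 0 ≤ r) :
    (expectedFlips G x r).toReal = ∫ s in (0 : ℝ)..r, Real.exp (G x x * s) *
      (-G x x + ∑ y, (if y = x then 0 else G y x) * (expectedFlips G y (r - s)).toReal) := by
  have h0 : ∀ s, 0 ≤ Real.exp (G x x * s) *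
      (-G x x + ∑ y, (if y = x then 0 else G y x) * (expectedFlips G y (r - s)).toReal) := fun s =>
    mul_nonneg (Real.exp_nonneg _) (add_nonneg (neg_nonneg.2 (hG.diag_nonpos x))
      (Finset.sum_nonneg fun y _ => mul_nonneg (hG.rate_nonneg x y) ENNReal.toReal_nonneg))
  rw [expectedFlips_renewal hG, ← ENNReal.toReal_ofReal
    (intervalIntegral.integral_nonneg hr fun s _ => h0 s), ← setLIntegral_Ioo_ofReal hr _
    fun s _ => h0 s]
  · congr 1
    refine lintegral_congr fun s => ?_
    rw [ENNReal.ofReal_mul (Real.exp_nonneg _), ENNReal.ofReal_add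
      (neg_nonneg.2 (hG.diag_nonpos x)) (Finset.sum_nonneg fun y _ =>
        mul_nonneg (hG.rate_nonneg x y) ENNReal.toReal_nonneg),
      ENNReal.ofReal_sum_of_nonneg fun y _ =>
        mul_nonneg (hG.rate_nonneg x y) ENNReal.toReal_nonneg]
    simp only [ENNReal.ofReal_mul (hG.rate_nonneg x _),
      ENNReal.ofReal_toReal (expectedFlips_ne_top hG _ _)]
  · refine IntervalIntegrable.continuousOn_mul ?_ (by fun_prop)
    have h1 : ∀ y, IntervalIntegrable (fun s => (if y = x then 0 else G y x) *
        (expectedFlips G y (r - s)).toReal) volume 0 r := fun y =>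
      IntervalIntegrable.const_mul (Antitone.intervalIntegrable fun s s' h =>
        monotone_expectedFlips_toReal hG y (sub_le_sub_left h r)) _
    have h2 := IntervalIntegrable.sum Finset.univ fun y _ => h1 y
    rw [Finset.sum_fn] at h2
    exact intervalIntegrable_const.add h2

/-! ### Linear growth from a stationary weight -/

/-- If `a` solves the renewal equations of the rate matrix `G`, and `p` is a stationary weight of
`G`, then the average of `a` grows linearly. -/
theorem sum_mul_renewal_solution {ι : Type*} [Fintype ι] [DecidableEq ι] (G : Matrix ι ι ℝ)
    (p : ι → ℝ) (hp : G *ᵥ p = 0) (a : ι → ℝ → ℝ) (ha : ∀ x, Monotone (a x))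
    (hren : ∀ x r, 0 ≤ r → a x r = ∫ s in (0 : ℝ)..r, Real.exp (G x x * s) *
      (-G x x + ∑ y, (if y = x then 0 else G y x) * a y (r - s)))
    {t : ℝ} (ht : 0 ≤ t) :
    ∑ x, p x * a x t = t * ∑ x, p x * -G x x := by
  -- The substitution `v = r - s` removes `r` from the integrand, so regularity in `r` can be read
  -- off.
  have hrep : ∀ x r, 0 ≤ r → a x r = Real.exp (G x x * r) * ∫ v in (0 : ℝ)..r,
      Real.exp (-G x x * v) * (-G x x + ∑ y, (if y = x then 0 else G y x) * a y v) := by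
    intro x r hr
    rw [hren x r hr, ← intervalIntegral.integral_const_mul]
    have h := intervalIntegral.integral_comp_sub_left (a := 0) (b := r) (fun v =>
      Real.exp (G x x * (r - v)) * (-G x x + ∑ y, (if y = x then 0 else G y x) * a y v)) r
    simp only [sub_sub_cancel, sub_self, sub_zero] at h
    rw [h]
    refine intervalIntegral.integral_congr fun v _ => ?_
    rw [← mul_assoc, ← Real.exp_add]
    ring_nf
  -- So far `a` is only monotone, hence integrable; as a primitive it agrees on `r ≥ 0` with a
  -- continuous function.
  have hcont : ∀ x, ∃ b : ℝ → ℝ, Continuous b ∧ ∀ r, 0 ≤ r → a x r = b r := by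
    intro x
    refine ⟨_, ?_, hrep x⟩
    refine Continuous.mul (by fun_prop) (intervalIntegral.continuous_primitive (fun r r' => ?_) 0)
    refine IntervalIntegrable.continuousOn_mul ?_ (by fun_prop)
    have h1 : ∀ y, IntervalIntegrable (fun s => (if y = x then 0 else G y x) * a y s)
        volume r r' := fun y => (ha y).intervalIntegrable.const_mul _
    have h2 := IntervalIntegrable.sum Finset.univ fun y _ => h1 y
    rw [Finset.sum_fn] at h2
    exact intervalIntegrable_const.add h2
  choose b hb hab using hcont
  -- With `b` in the integrand, `c` is differentiable on all of `ℝ`, so no one-sided derivative at 0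
  -- is needed. The functions `a`, `b`, `c` agree only for `r ≥ 0`.
  let c : ι → ℝ → ℝ := fun x r => Real.exp (G x x * r) * ∫ v in (0 : ℝ)..r,
      Real.exp (-G x x * v) * (-G x x + ∑ y, (if y = x then 0 else G y x) * b y v)
  have hac : ∀ x r, 0 ≤ r → a x r = c x r := by
    intro x r hr
    rw [hrep x r hr]
    congr 1
    refine intervalIntegral.integral_congr fun v hv => ?_
    rw [Set.uIcc_of_le hr] at hv
    simp only [hab _ v hv.1]
  have hc : ∀ x r, HasDerivAt (c x)
      (G x x * c x r + (-G x x + ∑ y, (if y = x then 0 else G y x) * b y r)) r := by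
    intro x r
    have h1 : HasDerivAt (fun r => Real.exp (G x x * r)) (Real.exp (G x x * r) * G x x) r := by
      simpa using ((hasDerivAt_id r).const_mul (G x x)).exp
    have hcont : Continuous fun v => Real.exp (-G x x * v) *
        (-G x x + ∑ y, (if y = x then 0 else G y x) * b y v) := by fun_prop
    have h2 := intervalIntegral.integral_hasDerivAt_right (hcont.intervalIntegrable 0 r)
      (hcont.stronglyMeasurableAtFilter _ _) hcont.continuousAt
    refine (h1.mul h2).congr_deriv ?_
    have h3 : Real.exp (G x x * r) * Real.exp (-G x x * r) = 1 := by
      rw [← Real.exp_add]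
      simp
    rw [← mul_assoc, h3]
    simp only [c]
    ring
  have hsum : ∀ r, 0 ≤ r → HasDerivAt (fun r => ∑ x, p x * c x r) (∑ x, p x * -G x x) r := by
    intro r hr
    refine (HasDerivAt.fun_sum fun x _ => (hc x r).const_mul (p x)).congr_deriv ?_
    have h1 : ∀ x, p x * (G x x * c x r +
        (-G x x + ∑ y, (if y = x then 0 else G y x) * b y r)) =
        p x * -G x x + ∑ y, G y x * p x * c y r := by
      intro x
      have h2 : ∀ y, b y r = c y r := fun y => (hab y r hr).symm.trans (hac y r hr)
      -- The term `G x x * c x r` fills in the missing `y = x` summand, leaving the full sum of `G y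
      -- x * c y r`; exchanging sums then exposes `G *ᵥ p = 0`.
      have h3 : ∀ y, (if y = x then 0 else G y x) * c y r =
          G y x * c y r - if y = x then G x x * c x r else 0 := by
        intro y
        split_ifs with h
        · simp [h]
        · ring
      simp only [h2, h3, Finset.sum_sub_distrib, Finset.sum_ite_eq', Finset.mem_univ, if_true]
      rw [← add_sub_assoc, add_sub_cancel, mul_add, Finset.mul_sum]
      congr 1
      exact Finset.sum_congr rfl fun y _ => by ring
    simp only [h1]
    rw [Finset.sum_add_distrib, Finset.sum_comm]
    have h4 : ∀ y, ∑ x, G y x * p x * c y r = 0 := fun y => by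
      rw [← Finset.sum_mul, show ∑ x, G y x * p x = (G *ᵥ p) y from rfl, hp]
      simp
    simp [h4]
  have hfin := intervalIntegral.integral_eq_sub_of_hasDerivAt (a := 0) (b := t)
    (f := fun r => ∑ x, p x * c x r) (f' := fun _ => ∑ x, p x * -G x x)
    (fun r hr => hsum r (by rw [Set.uIcc_of_le ht] at hr; exact hr.1)) intervalIntegrable_const
  simp only [hac _ t ht]
  rw [intervalIntegral.integral_const] at hfin
  simpa [c] using hfin.symm

/-- For a Markov process started in a stationary weight, the mean number of jumps is the time
multiplied by the mean jump rate. -/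
theorem sum_mul_expectedFlips {G : Matrix (Bits n) (Bits n) ℝ} (hG : IsGenerator G)
    {p : Bits n → ℝ} (hp : G *ᵥ p = 0) {t : ℝ} (ht : 0 ≤ t) :
    ∑ x, p x * (expectedFlips G x t).toReal = t * ∑ x, p x * -G x x :=
  sum_mul_renewal_solution G p hp (fun x t => (expectedFlips G x t).toReal)
    (monotone_expectedFlips_toReal hG) (fun x _ hr => expectedFlips_toReal_renewal hG x hr) ht

/-! ### The fixed-node Hamiltonian and its ground energy -/

section FixedNodeHamiltonian

variable {H : Matrix (Bits n) (Bits n) ℝ} {ψ : Bits n → ℝ}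

theorem swap_mem_SPlus (hH : H.IsSymm) {x y : Bits n} (h : (x, y) ∈ SPlus H ψ) :
    (y, x) ∈ SPlus H ψ := by
  refine ⟨h.1.symm, ?_⟩
  have h2 : 0 < ψ x * H x y * ψ y := h.2
  change 0 < ψ y * H y x * ψ x
  rw [hH.apply]
  linarith

theorem fixedNode_symm (hH : H.IsSymm) (x y : Bits n) :
    fixedNode H ψ x y = fixedNode H ψ y x := by
  by_cases hxy : x = y
  · rw [hxy]
  · have hiff : (x, y) ∈ SPlus H ψ ↔ (y, x) ∈ SPlus H ψ :=
      ⟨swap_mem_SPlus hH, swap_mem_SPlus hH⟩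
    simp only [fixedNode, Matrix.of_apply, if_neg hxy, if_neg (Ne.symm hxy), hH.apply y x]
    by_cases h : (x, y) ∈ SPlus H ψ
    · rw [if_pos h, if_pos (hiff.1 h)]
    · rw [if_neg h, if_neg fun h' => h (hiff.2 h')]

/-- Applied to `ψ`, the diagonal correction in row `x` contributes exactly the terms `H x z * ψ z`
that deleting the pairs in `SPlus` removed. -/
theorem fixedNode_mulVec (hψ0 : ∀ x, ψ x ≠ 0) : fixedNode H ψ *ᵥ ψ = H *ᵥ ψ := by
  classical
  ext x
  have hterm : ∀ y, fixedNode H ψ x y * ψ y =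
      (H x y * ψ y - if (x, y) ∈ SPlus H ψ then H x y * ψ y else 0) +
        if x = y then ∑ z, (if (x, z) ∈ SPlus H ψ then H x z * ψ z else 0) else 0 := by
    intro y
    by_cases hxy : x = y
    · subst hxy
      have hx : (x, x) ∉ SPlus H ψ := fun h => h.1 rfl
      simp only [fixedNode, Matrix.of_apply, if_true, if_neg hx, sub_zero, add_mul,
        Finset.sum_mul]
      congr 1
      refine Finset.sum_congr rfl fun z _ => ?_
      split_ifs
      · rw [mul_assoc, div_mul_cancel₀ _ (hψ0 x)]
      · rw [zero_mul]
    · simp only [fixedNode, Matrix.of_apply, if_neg hxy]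
      split_ifs <;> simp
  simp only [Matrix.mulVec, dotProduct, hterm, Finset.sum_add_distrib, Finset.sum_sub_distrib,
    Finset.sum_ite_eq, Finset.mem_univ, if_true, sub_add_cancel]

theorem mul_fixedNode_mul_nonpos {x y : Bits n} (hxy : x ≠ y) :
    ψ x * fixedNode H ψ x y * ψ y ≤ 0 := by
  simp only [fixedNode, Matrix.of_apply, if_neg hxy]
  split_ifs with h
  · simp
  · exact not_lt.1 fun h' => h ⟨hxy, h'⟩

theorem abs_fixedNode_le {x y : Bits n} (hxy : x ≠ y) : |fixedNode H ψ x y| ≤ |H x y| := by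
  simp only [fixedNode, Matrix.of_apply, if_neg hxy]
  split_ifs
  · simp
  · exact le_rfl

end FixedNodeHamiltonian

/-- An eigenvector without zero entries with respect to which all off-diagonal matrix elements are
nonpositive belongs to the smallest eigenvalue. -/
theorem groundEnergy_eq_of_mulVec {M : Matrix (Bits n) (Bits n) ℝ} {ψ : Bits n → ℝ} {e : ℝ}
    (hψ0 : ∀ x, ψ x ≠ 0) (hoff : ∀ x y, x ≠ y → ψ x * M x y * ψ y ≤ 0)
    (hM : M *ᵥ ψ = e • ψ) : groundEnergy M = e := by
  have hspec : ∀ μ, μ ∈ spectrum ℝ M ↔ ∃ φ : Bits n → ℝ, φ ≠ 0 ∧ M *ᵥ φ = μ • φ := by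
    intro μ
    rw [← Matrix.spectrum_toLin', ← Module.End.hasEigenvalue_iff_mem_spectrum]
    constructor
    · intro h
      obtain ⟨φ, hφ⟩ := h.exists_hasEigenvector
      exact ⟨φ, hφ.2, by simpa using hφ.apply_eq_smul⟩
    · rintro ⟨φ, hφ, h⟩
      exact Module.End.hasEigenvalue_of_hasEigenvector
        (Module.End.hasEigenvector_iff.2 ⟨Module.End.mem_eigenspace_iff.2 (by simpa using h), hφ⟩)
  refine IsLeast.csInf_eq ⟨(hspec e).2 ⟨ψ, fun h => hψ0 (fun _ => false) (congrFun h _), hM⟩, ?_⟩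
  intro μ hμ
  obtain ⟨φ, hφ, hφM⟩ := (hspec μ).1 hμ
  obtain ⟨x, hx⟩ := Finite.exists_max fun x => |φ x / ψ x|
  have hgx : φ x / ψ x ≠ 0 := by
    intro h
    refine hφ (funext fun y => ?_)
    have h1 : |φ y / ψ y| ≤ 0 := by simpa [h] using hx y
    have h2 := abs_nonpos_iff.1 h1
    exact (div_eq_zero_iff.1 h2).resolve_right (hψ0 y)
  have hsum1 : ∑ y, M x y * φ y = μ * φ x := congrFun hφM x
  have hsum2 : ∑ y, M x y * ψ y = e * ψ x := congrFun hM x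
  -- Put `g = φ / ψ`, with `|g|` maximal at `x`. Then `g y * g x ≤ g x ^ 2`, and the weights are
  -- nonpositive off the diagonal. By row `x` of both eigenvalue equations the sum is `(μ - e) * (ψ
  -- x * g x) ^ 2`.
  have hkey : 0 ≤ ∑ y, (ψ x * M x y * ψ y) *
      ((φ y / ψ y) * (φ x / ψ x) - (φ x / ψ x) * (φ x / ψ x)) := by
    refine Finset.sum_nonneg fun y _ => ?_
    by_cases hxy : x = y
    · simp [hxy]
    · refine mul_nonneg_of_nonpos_of_nonpos (hoff x y hxy) (sub_nonpos.2 ?_)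
      calc (φ y / ψ y) * (φ x / ψ x) ≤ |φ y / ψ y| * |φ x / ψ x| := by
            rw [← abs_mul]
            exact le_abs_self _
        _ ≤ |φ x / ψ x| * |φ x / ψ x| := mul_le_mul_of_nonneg_right (hx y) (abs_nonneg _)
        _ = _ := abs_mul_abs_self _
  have heq : ∑ y, (ψ x * M x y * ψ y) *
      ((φ y / ψ y) * (φ x / ψ x) - (φ x / ψ x) * (φ x / ψ x)) =
      (μ - e) * (ψ x * (φ x / ψ x)) ^ 2 := by
    have h1 : ∀ y, (ψ x * M x y * ψ y) *
        ((φ y / ψ y) * (φ x / ψ x) - (φ x / ψ x) * (φ x / ψ x)) =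
        ψ x * (φ x / ψ x) * (M x y * φ y) - ψ x * (φ x / ψ x) ^ 2 * (M x y * ψ y) := by
      intro y
      have := hψ0 x
      have := hψ0 y
      field_simp
    simp only [h1]
    rw [Finset.sum_sub_distrib, ← Finset.mul_sum, ← Finset.mul_sum, hsum1, hsum2]
    have := hψ0 x
    field_simp
  rw [heq] at hkey
  have hpos : 0 < (ψ x * (φ x / ψ x)) ^ 2 := by
    have := mul_ne_zero (hψ0 x) hgx
    positivity
  nlinarith

/-! ### The generator and its stationary weight -/

section Generator

variable {H : Matrix (Bits n) (Bits n) ℝ} {ψ : Bits n → ℝ} {e : ℝ}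

theorem groundEnergy_fixedNode (hψ0 : ∀ x, ψ x ≠ 0) (he : H *ᵥ ψ = e • ψ) :
    groundEnergy (fixedNode H ψ) = e :=
  groundEnergy_eq_of_mulVec hψ0 (fun _ _ => mul_fixedNode_mul_nonpos)
    ((fixedNode_mulVec hψ0).trans he)

theorem generator_apply (hψ0 : ∀ x, ψ x ≠ 0) (he : H *ᵥ ψ = e • ψ) (x y : Bits n) :
    generator H ψ x y = (if x = y then e else 0) - fixedNode H ψ x y * (ψ x / ψ y) := by
  rw [generator, Matrix.of_apply, groundEnergy_fixedNode hψ0 he]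

/-- Rates are nonnegative by the sign of `ψ x * F x y * ψ y`. Since `F` is symmetric, column `y` of
`G` sums to `e - (F *ᵥ ψ) y / ψ y = 0`. -/
theorem isGenerator_generator (hH : H.IsSymm) (hψ0 : ∀ x, ψ x ≠ 0) (he : H *ᵥ ψ = e • ψ) :
    IsGenerator (generator H ψ) where
  nonneg x y hxy := by
    rw [generator_apply hψ0 he, if_neg hxy, zero_sub]
    have h := mul_fixedNode_mul_nonpos (H := H) (ψ := ψ) hxy
    have h2 : fixedNode H ψ x y * (ψ x / ψ y) =
        ψ x * fixedNode H ψ x y * ψ y / (ψ y) ^ 2 := by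
      have := hψ0 y
      field_simp
    rw [h2]
    exact neg_nonneg.2 (div_nonpos_of_nonpos_of_nonneg h (sq_nonneg _))
  sum_col y := by
    have h : ∑ x, fixedNode H ψ y x * ψ x = e * ψ y :=
      congrFun ((fixedNode_mulVec hψ0).trans he) y
    simp only [generator_apply hψ0 he, Finset.sum_sub_distrib, Finset.sum_ite_eq',
      Finset.mem_univ, if_true]
    simp only [← mul_div_assoc, ← Finset.sum_div, fixedNode_symm hH _ y]
    rw [h, mul_div_cancel_right₀ _ (hψ0 y), sub_self]

theorem generator_mulVec_sq (hψ0 : ∀ x, ψ x ≠ 0) (he : H *ᵥ ψ = e • ψ) :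
    generator H ψ *ᵥ (fun x => ψ x ^ 2) = 0 := by
  ext x
  have h : ∑ y, fixedNode H ψ x y * ψ y = e * ψ x :=
    congrFun ((fixedNode_mulVec hψ0).trans he) x
  have hterm : ∀ y, generator H ψ x y * ψ y ^ 2 =
      (if x = y then e * ψ x ^ 2 else 0) - ψ x * (fixedNode H ψ x y * ψ y) := by
    intro y
    rw [generator_apply hψ0 he]
    have := hψ0 y
    split_ifs with hxy
    · subst hxy
      field_simp
    · field_simp
      ring
  simp only [Matrix.mulVec, dotProduct, hterm, Finset.sum_sub_distrib, Finset.sum_ite_eq,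
    Finset.mem_univ, if_true, ← Finset.mul_sum, h, Pi.zero_apply]
  ring

/-- This already holds row by row: `-G x x * ψ x = F x x * ψ x - e * ψ x`, and `e * ψ x` is the full
row sum of `F` against `ψ`. -/
theorem sum_sq_mul_neg_generator_diag (hψ0 : ∀ x, ψ x ≠ 0) (he : H *ᵥ ψ = e • ψ) :
    ∑ x, ψ x ^ 2 * -generator H ψ x x = -(ψ ⬝ᵥ (offDiag (fixedNode H ψ) *ᵥ ψ)) := by
  rw [dotProduct, ← Finset.sum_neg_distrib]
  refine Finset.sum_congr rfl fun x _ => ?_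
  have h : ∑ y, fixedNode H ψ x y * ψ y = e * ψ x :=
    congrFun ((fixedNode_mulVec hψ0).trans he) x
  have hterm : ∀ y, offDiag (fixedNode H ψ) x y * ψ y =
      fixedNode H ψ x y * ψ y - if x = y then fixedNode H ψ x x * ψ x else 0 := by
    intro y
    rw [offDiag, Matrix.of_apply]
    split_ifs with hxy
    · simp [hxy]
    · simp
  simp only [Matrix.mulVec, dotProduct, hterm, Finset.sum_sub_distrib, Finset.sum_ite_eq,
    Finset.mem_univ, if_true, h]
  rw [generator_apply hψ0 he, if_pos rfl, div_self (hψ0 x)]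
  ring

end Generator

/-! ### Locality and the bound on the flip rate -/

section Locality

/-- A nonzero entry of the sum needs a nonzero entry in some local term, which forces agreement
outside its support. -/
theorem IsLocal.card_filter_ne_le {k : ℕ} {H : Matrix (Bits n) (Bits n) ℂ} (hH : IsLocal k H)
    {x y : Bits n} (hxy : H x y ≠ 0) : (Finset.univ.filter fun i => x i ≠ y i).card ≤ k := by
  obtain ⟨m, S, T, hT, rfl⟩ := hH
  rw [Matrix.sum_apply] at hxy
  obtain ⟨a, -, ha⟩ := Finset.exists_ne_zero_of_sum_ne_zero hxy
  obtain ⟨hcard, -, A, hA⟩ := hT a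
  have hagree : ∀ i, i ∉ S a → x i = y i := by
    by_contra h
    exact ha (by rw [hA, if_neg h])
  refine (Finset.card_le_card fun i hi => ?_).trans hcard
  by_contra h
  exact (Finset.mem_filter.1 hi).2 (hagree i h)

/-- There are at most `n ^ k` nonempty subsets of `Fin n` with at most `k` elements. -/
theorem card_nonempty_card_le (n k : ℕ) :
    (Finset.univ.filter fun D : Finset (Fin n) => D.Nonempty ∧ D.card ≤ k).card ≤ n ^ k := by
  classical
  have h : (Finset.univ : Finset (Fin k → Fin n)).card = n ^ k := by simp
  rw [← h]
  refine Finset.card_le_card_of_surjOn (fun f => Finset.univ.image f) fun D hD => ?_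
  obtain ⟨hne, hcard⟩ := (Finset.mem_filter.1 (Finset.mem_coe.1 hD)).2
  have : Nonempty D := hne.to_subtype
  obtain ⟨g⟩ := Function.Embedding.nonempty_of_card_le (α := D) (β := Fin k) (by simpa using hcard)
  -- A left inverse of an injection `D ↪ Fin k` lists `D` as a `k`-tuple with repetitions; this is
  -- where `D` must be nonempty.
  refine ⟨fun i => (Function.invFun g i : D), by simp, ?_⟩
  ext i
  simp only [Finset.mem_image, Finset.mem_univ, true_and]
  constructor
  · rintro ⟨j, rfl⟩
    exact (Function.invFun g j).2
  · intro hi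
    exact ⟨g ⟨i, hi⟩, by rw [Function.leftInverse_invFun g.injective]⟩

/-- A row of a `k`-local Hamiltonian has at most `n ^ k` nonzero off-diagonal entries. -/
theorem IsLocal.card_offDiag_support_le {k : ℕ} {H : Matrix (Bits n) (Bits n) ℂ}
    (hH : IsLocal k H) (x : Bits n) :
    (Finset.univ.filter fun y => x ≠ y ∧ H x y ≠ 0).card ≤ n ^ k := by
  classical
  -- Bits are binary, so `y` is determined by the set of positions where it differs from `x`.
  refine (Finset.card_le_card_of_injOn (fun y => Finset.univ.filter fun i => x i ≠ y i)
    (fun y hy => ?_) fun y _ z _ h => ?_).trans (card_nonempty_card_le n k)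
  · obtain ⟨hne, h0⟩ := (Finset.mem_filter.1 (Finset.mem_coe.1 hy)).2
    obtain ⟨i, hi⟩ := Function.ne_iff.1 hne
    exact Finset.mem_coe.2 (Finset.mem_filter.2 ⟨Finset.mem_univ _,
      ⟨i, Finset.mem_filter.2 ⟨Finset.mem_univ _, hi⟩⟩, hH.card_filter_ne_le h0⟩)
  · funext i
    have hi : x i ≠ y i ↔ x i ≠ z i := by
      simpa using Finset.ext_iff.1 h i
    revert hi
    cases x i <;> cases y i <;> cases z i <;> simp

theorem abs_apply_le_norm_toEuclideanCLM {ι : Type*} [Fintype ι] [DecidableEq ι]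
    (M : Matrix ι ι ℝ) (x y : ι) : |M x y| ≤ ‖Matrix.toEuclideanCLM (𝕜 := ℝ) M‖ := by
  have h : M x y = inner ℝ (EuclideanSpace.single x (1 : ℝ))
      (Matrix.toEuclideanCLM (𝕜 := ℝ) M (EuclideanSpace.single y 1)) := by
    rw [Matrix.inner_toEuclideanCLM]
    simp
  rw [h]
  refine (abs_real_inner_le_norm _ _).trans ?_
  rw [PiLp.norm_single, norm_one, one_mul]
  refine (ContinuousLinearMap.le_opNorm _ _).trans ?_
  rw [PiLp.norm_single, norm_one, mul_one]

/-- AM–GM charges half of each entry to `ψ x ^ 2` and half to `ψ y ^ 2`. By symmetry both halves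
give the same double sum, and each row contributes at most `n ^ k` terms. -/
theorem neg_offDiag_fixedNode_le {k : ℕ} {H : Matrix (Bits n) (Bits n) ℝ} {ψ : Bits n → ℝ}
    (hH : H.IsSymm) (hlocal : IsLocal k (H.map Complex.ofReal)) (hψ : ψ ⬝ᵥ ψ = 1) :
    -(ψ ⬝ᵥ (offDiag (fixedNode H ψ) *ᵥ ψ)) ≤
      (n : ℝ) ^ k * ‖Matrix.toEuclideanCLM (𝕜 := ℝ) H‖ := by
  classical
  set h := ‖Matrix.toEuclideanCLM (𝕜 := ℝ) H‖
  have hh0 : 0 ≤ h := norm_nonneg _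
  have hterm : ∀ x y, -(ψ x * (offDiag (fixedNode H ψ) x y * ψ y)) ≤
      (if x ≠ y ∧ H x y ≠ 0 then h / 2 * ψ x ^ 2 else 0) +
        (if y ≠ x ∧ H y x ≠ 0 then h / 2 * ψ y ^ 2 else 0) := by
    intro x y
    have hiff : (y ≠ x ∧ H y x ≠ 0) ↔ (x ≠ y ∧ H x y ≠ 0) := by
      rw [ne_comm, hH.apply]
    simp only [hiff]
    by_cases hxy : x = y
    · simp [offDiag, hxy]
    · have hF := abs_fixedNode_le (H := H) (ψ := ψ) hxy
      have habs : -(ψ x * (offDiag (fixedNode H ψ) x y * ψ y)) ≤ |H x y| * (|ψ x| * |ψ y|) := by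
        calc _ ≤ |ψ x * (offDiag (fixedNode H ψ) x y * ψ y)| := neg_le_abs _
          _ = |fixedNode H ψ x y| * (|ψ x| * |ψ y|) := by
            rw [abs_mul, abs_mul, offDiag, Matrix.of_apply, if_neg hxy]
            ring
          _ ≤ _ := mul_le_mul_of_nonneg_right hF (by positivity)
      by_cases h0 : H x y = 0
      · simpa [h0] using habs
      · rw [if_pos ⟨hxy, h0⟩, if_pos ⟨hxy, h0⟩]
        have h1 := abs_apply_le_norm_toEuclideanCLM H x y
        have h2 : |ψ x| * |ψ y| ≤ (ψ x ^ 2 + ψ y ^ 2) / 2 := by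
          nlinarith [sq_nonneg (|ψ x| - |ψ y|), sq_abs (ψ x), sq_abs (ψ y)]
        calc _ ≤ |H x y| * (|ψ x| * |ψ y|) := habs
          _ ≤ h * ((ψ x ^ 2 + ψ y ^ 2) / 2) := mul_le_mul h1 h2 (by positivity) hh0
          _ = _ := by ring
  have hrow : ∀ x, ∑ y, (if x ≠ y ∧ H x y ≠ 0 then h / 2 * ψ x ^ 2 else 0) ≤
      (n : ℝ) ^ k * (h / 2 * ψ x ^ 2) := by
    intro x
    rw [← Finset.sum_filter, Finset.sum_const, nsmul_eq_mul]
    refine mul_le_mul_of_nonneg_right ?_ (by positivity)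
    have hc := hlocal.card_offDiag_support_le x
    simp only [Matrix.map_apply, ne_eq, Complex.ofReal_eq_zero] at hc
    exact_mod_cast hc
  have hnorm : ∑ x, ψ x ^ 2 = 1 := by
    rw [← hψ, dotProduct]
    exact Finset.sum_congr rfl fun x _ => sq (ψ x)
  have htotal : ∑ x, ∑ y, (if x ≠ y ∧ H x y ≠ 0 then h / 2 * ψ x ^ 2 else 0) ≤
      (n : ℝ) ^ k * (h / 2) := by
    refine (Finset.sum_le_sum fun x _ => hrow x).trans_eq ?_
    rw [← Finset.mul_sum, ← Finset.mul_sum, hnorm, mul_one]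
  calc -(ψ ⬝ᵥ (offDiag (fixedNode H ψ) *ᵥ ψ))
      = ∑ x, ∑ y, -(ψ x * (offDiag (fixedNode H ψ) x y * ψ y)) := by
        simp only [dotProduct, Matrix.mulVec, Finset.mul_sum, Finset.sum_neg_distrib]
    _ ≤ ∑ x, ∑ y, ((if x ≠ y ∧ H x y ≠ 0 then h / 2 * ψ x ^ 2 else 0) +
        (if y ≠ x ∧ H y x ≠ 0 then h / 2 * ψ y ^ 2 else 0)) :=
      Finset.sum_le_sum fun x _ => Finset.sum_le_sum fun y _ => hterm x y
    _ = ∑ x, ∑ y, (if x ≠ y ∧ H x y ≠ 0 then h / 2 * ψ x ^ 2 else 0) +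
        ∑ x, ∑ y, (if x ≠ y ∧ H x y ≠ 0 then h / 2 * ψ x ^ 2 else 0) := by
      simp only [Finset.sum_add_distrib]
      congr 1
      exact Finset.sum_comm
    _ ≤ (n : ℝ) ^ k * h := by linarith

end Locality

end FixedNode

theorem mainTheorem4 (n k : ℕ) (H : Matrix (FixedNode.Bits n) (FixedNode.Bits n) ℝ)
    (ψ : FixedNode.Bits n → ℝ)
    (hH : H.IsSymm)
    (hlocal : FixedNode.IsLocal k (H.map Complex.ofReal))
    (hψ : FixedNode.IsUniqueGroundState H ψ)
    (hpos : ∀ x, 0 < ψ x ^ 2)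
    (t : ℝ) (ht : 0 ≤ t) :
    (∀ x, FixedNode.expectedFlips (FixedNode.generator H ψ) x t ≠ ⊤) ∧
    ∑ x, ψ x ^ 2 * (FixedNode.expectedFlips (FixedNode.generator H ψ) x t).toReal
      = -t * (ψ ⬝ᵥ (FixedNode.offDiag (FixedNode.fixedNode H ψ) *ᵥ ψ)) ∧
    ∑ x, ψ x ^ 2 * (FixedNode.expectedFlips (FixedNode.generator H ψ) x t).toReal
      ≤ t * ((n : ℝ) ^ k * ‖Matrix.toEuclideanCLM (𝕜 := ℝ) H‖) := by
  have hψ0 : ∀ x, ψ x ≠ 0 := fun x => fun h => by simpa [h] using hpos x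
  have hG := FixedNode.isGenerator_generator hH hψ0 hψ.ground
  have hsum := FixedNode.sum_mul_expectedFlips hG
    (FixedNode.generator_mulVec_sq hψ0 hψ.ground) ht
  rw [FixedNode.sum_sq_mul_neg_generator_diag hψ0 hψ.ground] at hsum
  refine ⟨fun x => FixedNode.expectedFlips_ne_top hG x t, ?_, ?_⟩
  · rw [hsum, mul_neg, neg_mul]
  · rw [hsum]
    exact mul_le_mul_of_nonneg_left
      (FixedNode.neg_offDiag_fixedNode_le hH hlocal hψ.normalized) ht
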